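/- **Setting.** Let $M\ge 2$ be the number of labels and let $(\mathcal X,\mu)$ be a $\sigma$-finite measure space: for instance a countable set with counting measure $\mu$, or a Borel subset of $\mathbb R^k$ with Lebesgue measure, in which case all the $p$'s below are densities. Let $\{p(x,y\mid\theta):\theta\in\Lambda\}$ be a jointly measurable parametric family of probability densities on $\mathcal X\times\{1,\dots,M\}$ (with respect to $\mu$ times counting measure), and let $q$ be a prior probability distribution on the measurable space $\Lambda$. Put $p(x)=\int\sum_y p(x,y\mid\theta)\,dq(\theta)$, and let $W(y\mid x,\theta)=p(x,y\mid\theta)/\sum_{y'}p(x,y'\mid\theta)$ be the regression function, a random function when $\theta\sim q$. All logarithms are natural. **Rate-distortion function.** For $D>0$ let $R_p(D)=\inf I(W;\hat W)$, the infimum being over all joint laws of $(W,\hat W)$ in which $W$ has its given law and $\hat W=\hat W(y\mid x)$ is a random real-valued function, such that the inner expectation below is a measurable function of $x$ and the Bayes risk satisfies $$\mathcal L_p=\Bigl(\int_{\mathcal X} p(x)\,E\Bigl[\sum_{y=1}^M|W(y\mid x)-\hat W(y\mid x)|^p\Bigr]\,d\mu(x)\Bigr)^{1/p}\le D .$$ So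 the test point has density $p(x)$ and is independent of $(W,\hat W)$. For $p=\infty$, the inner expectation is replaced by the essential supremum of $\max_y|W(y\mid x)-\hat W(y\mid x)|$, and $\mathcal L_\infty$ is the essential supremum of that over $x$ with respect to $p(x)\,d\mu(x)$. **Interpolation maps.** For $S=\{x_1,\dots,x_{d_*}\}\subset\mathcal X$ (distinct points) let $W(S)$ be the $(M-1)\times d_*$ matrix $(W(y\mid x_i,\theta))_{y\le M-1,\,i\le d_*}$. $S$ is an *interpolation set* if the differential entropy $h(W(S))$ is well defined and finite. A measurable *interpolation map* $\mathfrak S:\mathcal V\to\mathcal X^{d_*}$ assigns to every index $v\in\mathcal V$ an interpolation set $\mathfrak S(v)=\{\mathfrak S_1(v),\dots,\mathfrak S_{d_*}(v)\}$ of $d_*$ points, with $\mathfrak S(v)\cap\mathfrak S(v')=\emptyset$ for $v\ne v'$. Its range $\mathcal W(\mathfrak S)=\bigcup_v\mathfrak S(v)$ is assumed measurable, and $\gamma(\mathfrak S)=\int_{\mathcal W(\mathfrak S)}p(x)\,d\mu(x)$ is assumed positive. $\mathfrak S$ is *isotropic* if $p(x)=p(x')$ whenever $x,x'\in\mathfrak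 S(v)$ for some $v$. **Law of $V$.** Let $\nu$ be a measure on $\mathcal V$ that corresponds to $\mu$, that is, $\int_{\mathcal V}\sum_{i=1}^{d_*} f(\mathfrak S_i(v))\,d\nu(v)=\int_{\mathcal W(\mathfrak S)}f\,d\mu$ for all measurable $f\ge0$ (counting measure on $\mathcal V$ when $\mathcal X$ is countable and $\mu$ is counting measure). Let $V$ have density with respect to $\nu$ proportional to $p(v)=p(x_v)$, where $x_v\in\mathfrak S(v)$ is any point, chosen measurably; for isotropic $\mathfrak S$ the choice does not matter. Assume that $E_V[h(W(\mathfrak S(V)))]$ is finite. **Claim.** For every $D>0$, with $[t]^+=\max\{t,0\}$: 1. if $\mathfrak S$ is isotropic, then $$R_1(D)\ge\Bigl[E_V[h(W(\mathfrak S(V)))]-d_*(M-1)\log\Bigl(\frac{2e}{(M-1)\gamma(\mathfrak S)}D\Bigr)\Bigr]^+;$$ 2. if $\mathfrak S$ is isotropic, then $$R_2(D)\ge\Bigl[E_V[h(W(\mathfrak S(V)))]-d_*(M-1)\log\Bigl(\sqrt{\frac{2\pi e}{(M-1)\gamma(\mathfrak S)}}\,D\Bigr)\Bigr]^+;$$ 3.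 for any such interpolation map, isotropic or not, for which in every $\mathfrak S(v)$ the density $p$ vanishes at all points or at none (automatic if $\mathfrak S$ is isotropic or $p>0$), $$R_\infty(D)\ge\bigl[E_V[h(W(\mathfrak S(V)))]-d_*(M-1)\log(2D)\bigr]^+ .$$ -/

import Mathlib

open MeasureTheory Set
open scoped ENNReal NNReal

namespace RateDistortion

section Entropy

variable {ι : Type*} [Fintype ι]

/-- The differential entropy of the law `ρ` on `ℝ^ι` is well defined and finite: `ρ` has a Lebesgue
density `f`, and `f log f` is integrable. -/
def HasFiniteDiffEntropy (ρ : Measure (ι → ℝ)) : Prop :=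
  ρ ≪ volume ∧
    Integrable (fun u => Real.negMulLog (ρ.rnDeriv volume u).toReal) (volume : Measure (ι → ℝ))

/-- The differential entropy `h = -∫ f log f` (in nats) of a law with Lebesgue density `f`. -/
noncomputable def diffEntropy (ρ : Measure (ι → ℝ)) : ℝ :=
  ∫ u, Real.negMulLog (ρ.rnDeriv volume u).toReal

end Entropy

/-- The mutual information (in nats) of two random elements with joint law `π`. -/
noncomputable def mutualInfo {α β : Type*} [MeasurableSpace α] [MeasurableSpace β]
    (π : Measure (α × β)) : ℝ≥0∞ :=
  InformationTheory.klDiv π (π.fst.prod π.snd)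

/-- A parametric family `p(x, y | θ)` of joint distributions of a data point `x ∈ 𝒳` and a label
`y ∈ {1, …, M}`, given by joint densities with respect to `μ` in `x` and counting measure in `y`.
For discrete data `μ` is the counting measure, for continuous data it is Lebesgue measure. -/
structure ParametricFamily (Λ 𝒳 : Type*) [MeasurableSpace Λ] [MeasurableSpace 𝒳] (M : ℕ)
    (μ : Measure 𝒳) where
  pdf : Λ → 𝒳 → Fin M → ℝ≥0
  measurable_pdf : ∀ y, Measurable fun z : Λ × 𝒳 => pdf z.1 z.2 y
  lintegral_pdf : ∀ θ, ∫⁻ x, ∑ y, (pdf θ x y : ℝ≥0∞) ∂μ = 1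

section Risk

variable {𝒳 : Type*} [MeasurableSpace 𝒳] {M : ℕ}

/-- The loss at the test point `x`, averaged over the joint law `π` of the true and the estimated
regression function: `E ∑_y |W(y|x) - Ŵ(y|x)|^p` when `p < ∞`, and the essential supremum of
`max_y |W(y|x) - Ŵ(y|x)|` when `p = ∞`. -/
noncomputable def pointRisk (p : ℝ≥0∞) (π : Measure ((𝒳 → Fin M → ℝ) × (𝒳 → Fin M → ℝ)))
    (x : 𝒳) : ℝ≥0∞ :=
  if p = ∞ then essSup (fun z => ⨆ y, ‖z.1 x y - z.2 x y‖ₑ) π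
  else ∫⁻ z, ∑ y, ‖z.1 x y - z.2 x y‖ₑ ^ p.toReal ∂π

/-- The Bayes risk `(E ∑_y |W(y|X) - Ŵ(y|X)|^p)^(1/p)` for a test point `X` with law `P`; for
`p = ∞` it is the essential supremum of `max_y |W(y|X) - Ŵ(y|X)|`. -/
noncomputable def bayesRisk (p : ℝ≥0∞) (P : Measure 𝒳)
    (π : Measure ((𝒳 → Fin M → ℝ) × (𝒳 → Fin M → ℝ))) : ℝ≥0∞ :=
  if p = ∞ then essSup (pointRisk p π) P
  else (∫⁻ x, pointRisk p π x ∂P) ^ (1 / p.toReal)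

end Risk

namespace ParametricFamily

variable {Λ 𝒳 : Type*} [MeasurableSpace Λ] [MeasurableSpace 𝒳] {M : ℕ} {μ : Measure 𝒳}

/-- The regression function `W(y | x, θ) = p(x, y | θ) / ∑_{y'} p(x, y' | θ)`. -/
noncomputable def regression (F : ParametricFamily Λ 𝒳 M μ) (θ : Λ) (x : 𝒳) (y : Fin M) : ℝ :=
  (F.pdf θ x y : ℝ) / ∑ y', (F.pdf θ x y' : ℝ)

/-- The density `p(x) = ∫ ∑_y p(x, y | θ) dq(θ)` of the data point under the prior `q`. -/
noncomputable def marginal (F : ParametricFamily Λ 𝒳 M μ) (q : Measure Λ) (x : 𝒳) : ℝ≥0∞ :=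
  ∫⁻ θ, ∑ y, (F.pdf θ x y : ℝ≥0∞) ∂q

/-- The law of the data point. -/
noncomputable def dataLaw (F : ParametricFamily Λ 𝒳 M μ) (q : Measure Λ) : Measure 𝒳 :=
  μ.withDensity (F.marginal q)

/-- The law of the random regression function `W(· | ·, θ)`, `θ ∼ q`, on the product space. -/
noncomputable def regressionLaw (F : ParametricFamily Λ 𝒳 M μ) (q : Measure Λ) :
    Measure (𝒳 → Fin M → ℝ) :=
  q.map F.regression

/-- The rate-distortion function `R_p(D)`: the infimum of `I(W; Ŵ)` over the joint laws of
`(W, Ŵ)` whose first marginal is the law of `W` and whose Bayes risk is well defined and at most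
`D`; the test point is drawn from `p(x)` independently of `(W, Ŵ)`. -/
noncomputable def rateDistortion (F : ParametricFamily Λ 𝒳 M μ) (q : Measure Λ) (p : ℝ≥0∞)
    (D : ℝ) : ℝ≥0∞ :=
  ⨅ π ∈ {π : Measure ((𝒳 → Fin M → ℝ) × (𝒳 → Fin M → ℝ)) |
      π.fst = F.regressionLaw q ∧ AEMeasurable (pointRisk p π) (F.dataLaw q) ∧
        bayesRisk p (F.dataLaw q) π ≤ ENNReal.ofReal D}, mutualInfo π

/-- The law of the matrix `W(S)` of the first `M - 1` values of the regression function at the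
points `S = (x₁, …, x_d)`. -/
noncomputable def sampleLaw (F : ParametricFamily Λ 𝒳 M μ) (q : Measure Λ) {d : ℕ}
    (S : Fin d → 𝒳) : Measure (Fin (M - 1) × Fin d → ℝ) :=
  q.map fun θ j => F.regression θ (S j.2) (Fin.castLE (Nat.sub_le M 1) j.1)

/-- `S = {x₁, …, x_d}` (with `d` distinct points) is an interpolation set: the differential entropy
`h(W(S))` is well defined and finite. -/
def IsInterpolationSet (F : ParametricFamily Λ 𝒳 M μ) (q : Measure Λ) {d : ℕ}
    (S : Fin d → 𝒳) : Prop :=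
  Function.Injective S ∧ HasFiniteDiffEntropy (F.sampleLaw q S)

variable {V : Type*} [MeasurableSpace V] {d : ℕ}

/-- The range `{x : ∃ v, x ∈ 𝔖(v)}`. -/
def mapRange (𝔖 : V → Fin d → 𝒳) : Set 𝒳 := {x | ∃ v, x ∈ Set.range (𝔖 v)}

/-- `𝔖` is a (measurable) interpolation map: the `𝔖(v)` are pairwise disjoint interpolation
sets. -/
structure IsInterpolationMap (F : ParametricFamily Λ 𝒳 M μ) (q : Measure Λ)
    (𝔖 : V → Fin d → 𝒳) : Prop where
  measurable : ∀ i, Measurable fun v => 𝔖 v i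
  measurableSet_range : MeasurableSet (mapRange 𝔖)
  isInterpolationSet : ∀ v, F.IsInterpolationSet q (𝔖 v)
  disjoint : ∀ v v', v ≠ v' → Disjoint (Set.range (𝔖 v)) (Set.range (𝔖 v'))

/-- The probability `γ(𝔖)` of the range. -/
noncomputable def mapProb (F : ParametricFamily Λ 𝒳 M μ) (q : Measure Λ)
    (𝔖 : V → Fin d → 𝒳) : ℝ :=
  (∫⁻ x in mapRange 𝔖, F.marginal q x ∂μ).toReal

/-- `p(x) = p(x')` for all `x, x' ∈ 𝔖(v)`. -/
def IsIsotropic (F : ParametricFamily Λ 𝒳 M μ) (q : Measure Λ) (𝔖 : V → Fin d → 𝒳) : Prop :=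
  ∀ v i j, F.marginal q (𝔖 v i) = F.marginal q (𝔖 v j)

/-- `ν` is the reference measure `dv` on the index set that corresponds to the reference measure
`μ = dx` on `𝒳`: integrating over `v` and summing over the points of `𝔖(v)` amounts to integrating
`dx` over the range of `𝔖`. If `μ` is the counting measure of a countable `𝒳`, the counting measure
of the index set has this property (`isIndexMeasure_count`). -/
def IsIndexMeasure (μ : Measure 𝒳) (𝔖 : V → Fin d → 𝒳) (ν : Measure V) : Prop :=
  ∑ i, ν.map (fun v => 𝔖 v i) = μ.restrict (mapRange 𝔖)

/-- The law of the random index `V`: its density with respect to `ν` is `p(v) = p(x)`, normalized,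
where `x = 𝔖(v)_{c(v)}` is the chosen point of `𝔖(v)` (for isotropic `𝔖` any point gives the same
law). -/
noncomputable def indexLaw (F : ParametricFamily Λ 𝒳 M μ) (q : Measure Λ) (𝔖 : V → Fin d → 𝒳)
    (ν : Measure V) (c : V → Fin d) : Measure V :=
  (∫⁻ v, F.marginal q (𝔖 v (c v)) ∂ν)⁻¹ • ν.withDensity fun v => F.marginal q (𝔖 v (c v))

/-- The averaged entropy `E_V[h(W(𝔖(V)))]`. -/
noncomputable def meanEntropy (F : ParametricFamily Λ 𝒳 M μ) (q : Measure Λ)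
    (𝔖 : V → Fin d → 𝒳) (ν : Measure V) (c : V → Fin d) : ℝ :=
  ∫ v, diffEntropy (F.sampleLaw q (𝔖 v)) ∂(F.indexLaw q 𝔖 ν c)

theorem isIndexMeasure_count [Countable 𝒳] [MeasurableSingletonClass 𝒳]
    [MeasurableSingletonClass V] {F : ParametricFamily Λ 𝒳 M μ} {q : Measure Λ}
    {𝔖 : V → Fin d → 𝒳} (h : F.IsInterpolationMap q 𝔖) :
    IsIndexMeasure (Measure.count : Measure 𝒳) 𝔖 Measure.count := by
  unfold IsIndexMeasure
  refine Measure.ext_of_singleton fun x => ?_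
  rw [Measure.finsetSum_apply, Measure.restrict_apply (measurableSet_singleton x)]
  by_cases hx : x ∈ mapRange 𝔖
  · obtain ⟨v, i, rfl⟩ := hx
    have hpre : ∀ j, (fun w => 𝔖 w j) ⁻¹' {𝔖 v i} = if j = i then {v} else ∅ := by
      intro j
      ext w
      have key : 𝔖 w j = 𝔖 v i → w = v ∧ j = i := by
        intro hw
        have hwv : w = v := by
          by_contra hne
          exact Set.disjoint_left.1 (h.disjoint w v hne) ⟨j, rfl⟩ ⟨i, hw.symm⟩
        subst hwv
        exact ⟨rfl, (h.isInterpolationSet w).1 hw⟩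
      by_cases hj : j = i
      · subst hj
        simp only [Set.mem_preimage, Set.mem_singleton_iff, if_true]
        exact ⟨fun hw => (key hw).1, fun hw => by rw [hw]⟩
      · simp only [Set.mem_preimage, Set.mem_singleton_iff, if_neg hj, Set.mem_empty_iff_false,
          iff_false]
        exact fun hw => hj (key hw).2
    have hin : ({𝔖 v i} : Set 𝒳) ∩ mapRange 𝔖 = {𝔖 v i} :=
      Set.inter_eq_left.2 (Set.singleton_subset_iff.2 ⟨v, i, rfl⟩)
    rw [hin, Measure.count_singleton]
    have : ∀ j, (Measure.count.map fun w => 𝔖 w j) {𝔖 v i} = if j = i then (1 : ℝ≥0∞) else 0 := by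
      intro j
      rw [Measure.map_apply (h.measurable j) (measurableSet_singleton _), hpre j]
      split_ifs <;> simp
    simp [this]
  · have hin : ({x} : Set 𝒳) ∩ mapRange 𝔖 = ∅ := by
      ext z
      simp only [Set.mem_inter_iff, Set.mem_singleton_iff, Set.mem_empty_iff_false, iff_false]
      rintro ⟨rfl, hz⟩
      exact hx hz
    rw [hin, measure_empty]
    refine Finset.sum_eq_zero fun j _ => ?_
    rw [Measure.map_apply (h.measurable j) (measurableSet_singleton _)]
    have : (fun w => 𝔖 w j) ⁻¹' {x} = ∅ := by
      ext w
      simp only [Set.mem_preimage, Set.mem_singleton_iff, Set.mem_empty_iff_false, iff_false]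
      exact fun hw => hx ⟨w, j, hw⟩
    rw [this, measure_empty]

end ParametricFamily

end RateDistortion

/-! At a fixed interpolation set, put X = W(S) and Y = Ŵ(S). For any density g on the matrix space,
I(W;Ŵ) ≥ h(X) + E log g(X - Y): this is Gibbs' inequality with test weight g(x - y)/f(x), where f is
the density of X. The weight depends on the pair only through the samples, so neither data
processing nor conditional densities are needed. This is
`ofReal_diffEntropy_add_integral_le_mutualInfo`.

For g take Laplace, Gaussian or uniform noise, the maximum-entropy law for the loss in question. In
the first two cases log g is affine in the loss, so the bound can be averaged over V with one fixed
scale and without Jensen. Isotropy turns E_V of the loss summed over 𝔖(V) into at most d/γ times the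
integrated risk (`IsIsotropic.lintegral_indexLaw_le`). Choosing the scale optimal for this averaged
loss gives the stated constants. For p = ∞ the risk bound holds at almost every data point, hence at
all points of almost every 𝔖(V) (`ae_indexLaw_of_ae_dataLaw`), and isotropy is not needed. -/

namespace RateDistortion

/-- **Gibbs' variational principle**: a weight `w = exp φ` of total `ν`-mass at most one bounds the
relative entropy from below by the mean of `φ`. -/
theorem ofReal_integral_le_klDiv {α : Type*} [MeasurableSpace α] {π ν : Measure α}
    [IsProbabilityMeasure π] [IsProbabilityMeasure ν] {w : α → ℝ≥0∞} {φ : α → ℝ}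
    (hw : Measurable w) (hw1 : ∫⁻ z, w z ∂ν ≤ 1)
    (hwφ : ∀ᵐ z ∂π, w z = ENNReal.ofReal (Real.exp (φ z))) (hφ : Integrable φ π) :
    ENNReal.ofReal (∫ z, φ z ∂π) ≤ InformationTheory.klDiv π ν := by
  by_cases hfin : InformationTheory.klDiv π ν = ∞
  · simp [hfin]
  obtain ⟨hac, hllr⟩ := InformationTheory.klDiv_ne_top_iff.1 hfin
  rw [InformationTheory.klDiv_of_ac_of_integrable hac hllr]
  simp only [probReal_univ, add_sub_cancel_right]
  refine ENNReal.ofReal_le_ofReal ?_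
  -- Only the part of ν absolutely continuous with respect to π enters here, so the mass of r is
  -- bounded by that of w, not equal to it.
  set r : α → ℝ≥0∞ := fun z => ν.rnDeriv π z * w z
  have hrm : Measurable r := (ν.measurable_rnDeriv π).mul hw
  have hr1 : ∫⁻ z, r z ∂π ≤ 1 := by
    have : ∫⁻ z, r z ∂π = ∫⁻ z, w z ∂(π.withDensity (ν.rnDeriv π)) :=
      (lintegral_withDensity_eq_lintegral_mul _ (ν.measurable_rnDeriv π) hw).symm
    rw [this]
    exact (lintegral_mono' (Measure.withDensity_rnDeriv_le ν π) le_rfl).trans hw1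
  have hrint : Integrable (fun z => (r z).toReal) π :=
    integrable_toReal_of_lintegral_ne_top hrm.aemeasurable (hr1.trans_lt ENNReal.one_lt_top).ne
  have hrint1 : ∫ z, (r z).toReal ∂π ≤ 1 := by
    rw [integral_toReal hrm.aemeasurable
      (ae_lt_top hrm (hr1.trans_lt ENNReal.one_lt_top).ne)]
    exact ENNReal.toReal_le_of_le_ofReal zero_le_one (by simpa using hr1)
  -- This is t ≤ exp t - 1 at t = φ - log(dπ/dν), where exp t = r.
  have hle : ∫ z, (φ z - llr π ν z) ∂π ≤ ∫ z, ((r z).toReal - 1) ∂π := by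
    refine integral_mono_ae (hφ.sub hllr) (hrint.sub (integrable_const _)) ?_
    filter_upwards [hwφ, exp_neg_llr hac] with z hz hz'
    have : (r z).toReal = Real.exp (φ z - llr π ν z) := by
      rw [ENNReal.toReal_mul, ← hz', hz, ENNReal.toReal_ofReal (Real.exp_pos _).le, ← Real.exp_add]
      congr 1; ring
    simp only [this]
    linarith [Real.add_one_le_exp (φ z - llr π ν z)]
  rw [integral_sub hφ hllr, integral_sub hrint (integrable_const _)] at hle
  simp only [integral_const, probReal_univ, smul_eq_mul, mul_one] at hle
  linarith

/-! ### Shannon lower bound and noise densities -/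

section Shannon

variable {ι : Type*} [Fintype ι]

theorem HasFiniteDiffEntropy.integrable_log {ρ : Measure (ι → ℝ)} [IsFiniteMeasure ρ]
    (h : HasFiniteDiffEntropy ρ) :
    Integrable (fun u => -Real.log (ρ.rnDeriv volume u).toReal) ρ := by
  rw [← integrable_rnDeriv_smul_iff h.1]
  refine h.2.congr (Filter.Eventually.of_forall fun u => ?_)
  simp [Real.negMulLog]

theorem HasFiniteDiffEntropy.integral_log {ρ : Measure (ι → ℝ)} [IsFiniteMeasure ρ]
    (h : HasFiniteDiffEntropy ρ) :
    ∫ u, -Real.log (ρ.rnDeriv volume u).toReal ∂ρ = diffEntropy ρ := by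
  rw [← integral_rnDeriv_smul h.1]
  refine integral_congr_ae (Filter.Eventually.of_forall fun u => ?_)
  simp [Real.negMulLog]

/-- **Shannon lower bound** with an arbitrary noise density `g = exp κ`: for random vectors
`X`, `Y` that are functions of the two components of a pair,
`h(X) + E κ(X - Y)` is at most the mutual information of the pair. -/
theorem ofReal_diffEntropy_add_integral_le_mutualInfo {α β : Type*} [MeasurableSpace α]
    [MeasurableSpace β] {π : Measure (α × β)} [IsProbabilityMeasure π]
    {X : α → ι → ℝ} {Y : β → ι → ℝ} (hX : Measurable X) (hY : Measurable Y)
    (hent : HasFiniteDiffEntropy (π.fst.map X))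
    {g : (ι → ℝ) → ℝ≥0∞} (hg : Measurable g) (hg1 : ∫⁻ u, g u ≤ 1) {κ : (ι → ℝ) → ℝ}
    (hgκ : ∀ᵐ z ∂π, g (X z.1 - Y z.2) = ENNReal.ofReal (Real.exp (κ (X z.1 - Y z.2))))
    (hκ : Integrable (fun z => κ (X z.1 - Y z.2)) π) :
    ENNReal.ofReal (diffEntropy (π.fst.map X) + ∫ z, κ (X z.1 - Y z.2) ∂π) ≤ mutualInfo π := by
  set ρ := π.fst.map X with hρ
  have : IsProbabilityMeasure ρ := Measure.isProbabilityMeasure_map hX.aemeasurable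
  set f := ρ.rnDeriv volume
  have hfm : Measurable f := ρ.measurable_rnDeriv volume
  have hmap : π.map (fun z => X z.1) = ρ := by
    rw [hρ, Measure.fst, Measure.map_map hX measurable_fst]; rfl
  have hXm : Measurable fun z : α × β => X z.1 := hX.comp measurable_fst
  have hmp : MeasurePreserving (fun z : α × β => X z.1) π ρ := ⟨hXm, hmap⟩
  have hYm : Measurable fun z : α × β => Y z.2 := hY.comp measurable_snd
  have hlog : Integrable (fun z : α × β => -Real.log (f (X z.1)).toReal) π :=
    hmp.integrable_comp_of_integrable hent.integrable_log
  have hlogint : ∫ z : α × β, -Real.log (f (X z.1)).toReal ∂π = diffEntropy ρ := by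
    rw [← hent.integral_log]
    conv_rhs => rw [← hmap]
    rw [integral_map hXm.aemeasurable, hmap]
    rw [hmap]
    exact hent.integrable_log.aestronglyMeasurable
  have hwm : Measurable fun z : α × β => g (X z.1 - Y z.2) * (f (X z.1))⁻¹ :=
    (hg.comp (hXm.sub hYm)).mul (hfm.comp hXm).inv
  have key := ofReal_integral_le_klDiv (π := π) (ν := π.fst.prod π.snd)
    (w := fun z => g (X z.1 - Y z.2) * (f (X z.1))⁻¹)
    (φ := fun z => -Real.log (f (X z.1)).toReal + κ (X z.1 - Y z.2))
    hwm ?_ ?_ (hlog.add hκ)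
  · rw [integral_add hlog hκ, hlogint] at key
    exact key
  -- Under the product of the marginals, integrate over the first component with the second fixed: f
  -- cancels, and translation invariance leaves the mass of g.
  · rw [lintegral_prod_symm _ hwm.aemeasurable]
    have hy : ∀ y, ∫⁻ x, g (X x - Y y) * (f (X x))⁻¹ ∂π.fst ≤ 1 := by
      intro y
      have hm : Measurable fun u => g (u - Y y) * (f u)⁻¹ :=
        (hg.comp (measurable_id.sub_const _)).mul hfm.inv
      calc ∫⁻ x, g (X x - Y y) * (f (X x))⁻¹ ∂π.fst
          = ∫⁻ u, g (u - Y y) * (f u)⁻¹ ∂ρ := (lintegral_map hm hX).symm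
        _ = ∫⁻ u, f u * (g (u - Y y) * (f u)⁻¹) :=
            (lintegral_rnDeriv_mul hent.1 hm.aemeasurable).symm
        _ ≤ ∫⁻ u, g (u - Y y) := by
            refine lintegral_mono fun u => ?_
            calc f u * (g (u - Y y) * (f u)⁻¹) = g (u - Y y) * (f u * (f u)⁻¹) := by ring
              _ ≤ g (u - Y y) * 1 := by gcongr; exact ENNReal.mul_inv_le_one _
              _ = _ := mul_one _
        _ = ∫⁻ u, g u := lintegral_sub_right_eq_self g (Y y)
        _ ≤ 1 := hg1
    exact (lintegral_mono hy).trans (by simp)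
  · have hpos : ∀ᵐ u ∂ρ, 0 < f u ∧ f u < ∞ :=
      (Measure.rnDeriv_pos hent.1).and (hent.1.ae_le (ρ.rnDeriv_lt_top volume))
    have hpos' : ∀ᵐ z ∂π, 0 < f (X z.1) ∧ f (X z.1) < ∞ :=
      hmp.quasiMeasurePreserving.ae hpos
    filter_upwards [hgκ, hpos'] with z hz hz'
    have : (f (X z.1))⁻¹ = ENNReal.ofReal (Real.exp (-Real.log (f (X z.1)).toReal)) := by
      have h0 := ENNReal.toReal_pos hz'.1.ne' hz'.2.ne
      rw [Real.exp_neg, Real.exp_log h0, ENNReal.ofReal_inv_of_pos h0,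
        ENNReal.ofReal_toReal hz'.2.ne]
    simp only [hz, this]
    rw [← ENNReal.ofReal_mul (Real.exp_pos _).le, ← Real.exp_add, add_comm]

/-- The integrand is a product of the one-dimensional densities exp(-c - a|t|^k), each of mass one.
-/
theorem lintegral_exp_neg_sum_abs_pow_le {k : ℕ} {a c : ℝ}
    (hi : Integrable fun t : ℝ => Real.exp (-a * |t| ^ k))
    (hc : ∫ t : ℝ, Real.exp (-a * |t| ^ k) = Real.exp c) :
    ∫⁻ u : ι → ℝ, ENNReal.ofReal
      (Real.exp (-(Fintype.card ι * c + a * ∑ j, |u j| ^ k))) ≤ 1 := by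
  have hprod : ∀ u : ι → ℝ, Real.exp (-(Fintype.card ι * c + a * ∑ j, |u j| ^ k)) =
      Real.exp (-(Fintype.card ι * c)) * ∏ j, Real.exp (-a * |u j| ^ k) := by
    intro u
    rw [← Real.exp_sum, ← Real.exp_add, ← Finset.mul_sum]
    congr 1; ring
  have hI : Integrable fun u : ι → ℝ => ∏ j, Real.exp (-a * |u j| ^ k) :=
    Integrable.fintype_prod (f := fun _ t => Real.exp (-a * |t| ^ k)) fun _ => hi
  simp_rw [hprod]
  rw [← ofReal_integral_eq_lintegral_ofReal (hI.const_mul _)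
    (Filter.Eventually.of_forall fun u => by positivity), integral_const_mul,
    integral_fintype_prod_volume_eq_pow (fun t => Real.exp (-a * |t| ^ k)), hc, ← Real.exp_nat_mul,
    ← Real.exp_add]
  simp

theorem integral_exp_neg_mul_abs {a : ℝ} (ha : 0 < a) :
    ∫ t : ℝ, Real.exp (-a * |t|) = 2 / a := by
  rw [integral_comp_abs (f := fun t => Real.exp (-a * t)),
    integral_exp_mul_Ioi (neg_lt_zero.2 ha) 0]
  simp
  ring

theorem integrable_exp_neg_mul_abs {a : ℝ} (ha : 0 < a) :
    Integrable fun t : ℝ => Real.exp (-a * |t|) := by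
  -- A non-integrable function has integral 0 by convention, so a nonzero value proves
  -- integrability.
  refine not_imp_comm.1 integral_undef ?_
  rw [integral_exp_neg_mul_abs ha]
  positivity

end Shannon

/-! ### Bounds at a single interpolation set -/

namespace ParametricFamily

/-- Evaluation of the first `M - 1` values of a function at the points of `S`. -/
def sampleMap {𝒳 : Type*} {M d : ℕ} (S : Fin d → 𝒳) (w : 𝒳 → Fin M → ℝ) : Fin (M - 1) × Fin d → ℝ :=
  fun j => w (S j.2) (Fin.castLE (Nat.sub_le M 1) j.1)

theorem measurable_sampleMap {𝒳 : Type*} {M d : ℕ} (S : Fin d → 𝒳) : Measurable (sampleMap (M := M) S) :=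
  measurable_pi_lambda _ fun j => (measurable_pi_apply _).comp (measurable_pi_apply (S j.2))

/-- Dropping the last label only decreases the loss; this links the M - 1 rows carrying the entropy
to a risk summed over all M labels. -/
theorem sum_sample_le {𝒳 : Type*} {M d : ℕ} (S : Fin d → 𝒳) (r : 𝒳 → Fin M → ℝ≥0∞) :
    ∑ j : Fin (M - 1) × Fin d, r (S j.2) (Fin.castLE (Nat.sub_le M 1) j.1) ≤
      ∑ i, ∑ y, r (S i) y := by
  rw [Fintype.sum_prod_type_right]
  refine Finset.sum_le_sum fun i _ => ?_
  calc ∑ y, r (S i) (Fin.castLE (Nat.sub_le M 1) y)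
      = ∑ y ∈ Finset.univ.map (Fin.castLEEmb (Nat.sub_le M 1)), r (S i) y :=
        (Finset.sum_map Finset.univ (Fin.castLEEmb (Nat.sub_le M 1)) (r (S i))).symm
    _ ≤ _ := Finset.sum_le_sum_of_subset (Finset.subset_univ _)

variable {Λ 𝒳 V : Type*} [MeasurableSpace Λ] [MeasurableSpace 𝒳] [MeasurableSpace V] {M d : ℕ}
  {μ : Measure 𝒳} {F : ParametricFamily Λ 𝒳 M μ} {q : Measure Λ} {𝔖 : V → Fin d → 𝒳}
  {ν : Measure V} {c : V → Fin d}

theorem measurable_regression (F : ParametricFamily Λ 𝒳 M μ) : Measurable F.regression := by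
  have h : ∀ x y, Measurable fun θ => (F.pdf θ x y : ℝ) := fun x y =>
    ((F.measurable_pdf y).comp (measurable_id.prodMk measurable_const)).coe_nnreal_real
  exact measurable_pi_lambda _ fun x => measurable_pi_lambda _ fun y =>
    (h x y).div (Finset.measurable_sum _ fun y' _ => h x y')

theorem measurable_marginal (F : ParametricFamily Λ 𝒳 M μ) (q : Measure Λ) [SFinite q] :
    Measurable (F.marginal q) := by
  have h : Measurable fun z : Λ × 𝒳 => ∑ y, (F.pdf z.1 z.2 y : ℝ≥0∞) :=
    Finset.measurable_sum _ fun y _ => (F.measurable_pdf y).coe_nnreal_ennreal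
  exact h.lintegral_prod_left'

theorem map_sampleMap_regressionLaw (S : Fin d → 𝒳) :
    (F.regressionLaw q).map (sampleMap S) = F.sampleLaw q S := by
  rw [regressionLaw, Measure.map_map (measurable_sampleMap S) F.measurable_regression]
  rfl

/-- The infimum runs over arbitrary measures; the constraint on the first marginal fixes the total
mass. -/
theorem isProbabilityMeasure_of_fst_eq [IsProbabilityMeasure q]
    {π : Measure ((𝒳 → Fin M → ℝ) × (𝒳 → Fin M → ℝ))} (hπ : π.fst = F.regressionLaw q) :
    IsProbabilityMeasure π := by
  have := Measure.isProbabilityMeasure_map (μ := q) F.measurable_regression.aemeasurable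
  exact ⟨by rw [← Measure.fst_univ, hπ, regressionLaw, measure_univ]⟩

/-- The Shannon lower bound at one interpolation set, for the noise density `∝ exp (-a |t| ^ k)`. -/
theorem diffEntropy_le_of_pointRisk [IsProbabilityMeasure q]
    {π : Measure ((𝒳 → Fin M → ℝ) × (𝒳 → Fin M → ℝ))} (hπ : π.fst = F.regressionLaw q)
    (hI : mutualInfo π ≠ ∞) {S : Fin d → 𝒳} (hS : F.IsInterpolationSet q S) {k : ℕ}
    (hfin : ∀ i, pointRisk k π (S i) ≠ ∞) {a b : ℝ} (ha : 0 < a)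
    (hi : Integrable fun t : ℝ => Real.exp (-a * |t| ^ k))
    (hb : ∫ t : ℝ, Real.exp (-a * |t| ^ k) = Real.exp b) :
    diffEntropy (F.sampleLaw q S) ≤ (mutualInfo π).toReal + ((M - 1 : ℕ) * d * b +
      a * (∑ i, pointRisk k π (S i)).toReal) := by
  have := isProbabilityMeasure_of_fst_eq hπ
  have hlaw : π.fst.map (sampleMap S) = F.sampleLaw q S := by
    rw [hπ, map_sampleMap_regressionLaw]
  set G : (𝒳 → Fin M → ℝ) × (𝒳 → Fin M → ℝ) → ℝ≥0∞ := fun z =>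
    ∑ j, ‖(sampleMap S z.1 - sampleMap S z.2) j‖ₑ ^ k with hG
  have hdiff : Measurable fun z : (𝒳 → Fin M → ℝ) × (𝒳 → Fin M → ℝ) =>
      sampleMap S z.1 - sampleMap S z.2 :=
    ((measurable_sampleMap S).comp measurable_fst).sub
      ((measurable_sampleMap S).comp measurable_snd)
  have hGm : Measurable G := Finset.measurable_sum _ fun j _ =>
    (((measurable_pi_apply j).comp hdiff).enorm).pow_const k
  have hGle : ∫⁻ z, G z ∂π ≤ ∑ i, pointRisk k π (S i) := by
    have hpr : ∀ x, pointRisk k π x = ∫⁻ z, ∑ y, ‖z.1 x y - z.2 x y‖ₑ ^ k ∂π := by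
      intro x
      simp [pointRisk]
    simp_rw [hpr]
    rw [← lintegral_finsetSum]
    · exact lintegral_mono fun z => sum_sample_le S fun x y => ‖z.1 x y - z.2 x y‖ₑ ^ k
    · intro i _
      refine Finset.measurable_sum _ fun y _ => ?_
      have h1 : Measurable fun w : 𝒳 → Fin M → ℝ => w (S i) y :=
        (measurable_pi_apply y).comp (measurable_pi_apply (S i))
      exact ((h1.comp measurable_fst).sub (h1.comp measurable_snd)).enorm.pow_const k
  have hsum : ∑ i, pointRisk k π (S i) ≠ ∞ := by
    simpa [ENNReal.sum_eq_top] using hfin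
  have hGfin : ∫⁻ z, G z ∂π ≠ ∞ := ne_top_of_le_ne_top hsum hGle
  have hGr : ∀ z, (G z).toReal = ∑ j, |(sampleMap S z.1 - sampleMap S z.2) j| ^ k := by
    intro z
    rw [hG, ENNReal.toReal_sum (by simp)]
    simp
  have hGint : Integrable (fun z => (G z).toReal) π :=
    integrable_toReal_of_lintegral_ne_top hGm.aemeasurable hGfin
  have hGle' : ∫ z, (G z).toReal ∂π ≤ (∑ i, pointRisk k π (S i)).toReal := by
    rw [integral_toReal hGm.aemeasurable (ae_lt_top hGm hGfin)]
    exact ENNReal.toReal_mono hsum hGle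
  set n : ℝ := (Fintype.card (Fin (M - 1) × Fin d) : ℝ) with hn
  have hκ : Integrable (fun z => -(n * b + a * (G z).toReal)) π :=
    ((integrable_const _).add (hGint.const_mul a)).neg
  have key := ofReal_diffEntropy_add_integral_le_mutualInfo (measurable_sampleMap S)
    (measurable_sampleMap S) (hlaw ▸ hS.2) (by fun_prop)
    (lintegral_exp_neg_sum_abs_pow_le (ι := Fin (M - 1) × Fin d) hi hb)
    (κ := fun u => -(n * b + a * ∑ j, |u j| ^ k))
    (Filter.Eventually.of_forall fun z => rfl) (by simpa only [hGr] using hκ)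
  simp only [← hGr] at key
  rw [hlaw, integral_neg, integral_add (integrable_const _) (hGint.const_mul a),
    integral_const_mul a] at key
  have key' := (ENNReal.ofReal_le_iff_le_toReal hI).1 key
  simp only [integral_const, probReal_univ, smul_eq_mul, one_mul] at key'
  have hn' : n = (M - 1 : ℕ) * d := by simp [hn]
  rw [hn'] at key'
  linarith [mul_le_mul_of_nonneg_left hGle' ha.le]

/-- The Shannon lower bound at one interpolation set for uniform noise. -/
theorem diffEntropy_le_of_pointRisk_top [IsProbabilityMeasure q]
    {π : Measure ((𝒳 → Fin M → ℝ) × (𝒳 → Fin M → ℝ))} (hπ : π.fst = F.regressionLaw q)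
    (hI : mutualInfo π ≠ ∞) {S : Fin d → 𝒳} (hS : F.IsInterpolationSet q S) {D : ℝ} (hD : 0 < D)
    (hrisk : ∀ i, pointRisk ∞ π (S i) ≤ ENNReal.ofReal D) :
    diffEntropy (F.sampleLaw q S) ≤
      (mutualInfo π).toReal + (M - 1 : ℕ) * d * Real.log (2 * D) := by
  have := isProbabilityMeasure_of_fst_eq hπ
  have hlaw : π.fst.map (sampleMap S) = F.sampleLaw q S := by
    rw [hπ, map_sampleMap_regressionLaw]
  set n : ℕ := Fintype.card (Fin (M - 1) × Fin d) with hn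
  -- The noise is uniform on this cube of volume (2D)^n. Its density vanishes outside, which is
  -- harmless because the error lies in the cube π-almost surely.
  set B : Set (Fin (M - 1) × Fin d → ℝ) := Icc (fun _ => -D) (fun _ => D)
  have hB : MeasurableSet B := measurableSet_Icc
  have hpow : Real.exp (-(n * Real.log (2 * D))) = ((2 * D) ^ n)⁻¹ := by
    rw [Real.exp_neg, Real.exp_nat_mul, Real.exp_log (by positivity)]
  have key := ofReal_diffEntropy_add_integral_le_mutualInfo (measurable_sampleMap S)
    (measurable_sampleMap S) (hlaw ▸ hS.2)
    (g := B.indicator fun _ => ENNReal.ofReal (Real.exp (-(n * Real.log (2 * D)))))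
    (measurable_const.indicator hB) ?_ (κ := fun _ => -(n * Real.log (2 * D))) ?_
    (integrable_const _)
  · rw [hlaw] at key
    have key' := (ENNReal.ofReal_le_iff_le_toReal hI).1 key
    simp only [integral_const, probReal_univ, smul_eq_mul, one_mul] at key'
    have hn' : (n : ℝ) = (M - 1 : ℕ) * d := by simp [hn]
    rw [hn'] at key'
    linarith
  · rw [lintegral_indicator_const hB, Real.volume_Icc_pi]
    simp only [sub_neg_eq_add, Finset.prod_const, Finset.card_univ, ← two_mul]
    rw [hpow, ← hn, ← ENNReal.ofReal_pow (by positivity), ← ENNReal.ofReal_mul (by positivity),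
      inv_mul_cancel₀ (by positivity)]
    simp
  · have hall : ∀ᵐ z ∂π, ∀ i, ⨆ y, ‖z.1 (S i) y - z.2 (S i) y‖ₑ ≤ ENNReal.ofReal D := by
      refine ae_all_iff.2 fun i => ?_
      have h := hrisk i
      rw [pointRisk, if_pos rfl] at h
      filter_upwards [ENNReal.ae_le_essSup
        (fun z : (𝒳 → Fin M → ℝ) × (𝒳 → Fin M → ℝ) => ⨆ y, ‖z.1 (S i) y - z.2 (S i) y‖ₑ)]
        with z hz using hz.trans h
    filter_upwards [hall] with z hz
    rw [indicator_of_mem]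
    have habs : ∀ j, |(sampleMap S z.1 - sampleMap S z.2) j| ≤ D := by
      intro j
      have h := (le_iSup (fun y => ‖z.1 (S j.2) y - z.2 (S j.2) y‖ₑ)
        (Fin.castLE (Nat.sub_le M 1) j.1)).trans (hz j.2)
      rw [← ofReal_norm, ENNReal.ofReal_le_ofReal_iff hD.le] at h
      exact h
    exact ⟨fun j => (abs_le.1 (habs j)).1, fun j => (abs_le.1 (habs j)).2⟩

/-! ### The law of the index and averaging over it -/

theorem IsIndexMeasure.sum_lintegral (hν : IsIndexMeasure μ 𝔖 ν)
    (h𝔖 : ∀ i, Measurable fun v => 𝔖 v i) {f : 𝒳 → ℝ≥0∞} (hf : Measurable f) :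
    ∫⁻ v, ∑ i, f (𝔖 v i) ∂ν = ∫⁻ x in mapRange 𝔖, f x ∂μ := by
  rw [← hν, lintegral_finsetSum_measure, 
    lintegral_finsetSum (f := fun i v => f (𝔖 v i)) _ fun i _ => hf.comp (h𝔖 i)]
  exact Finset.sum_congr rfl fun i _ => (lintegral_map hf (h𝔖 i)).symm

/-- The normalizing constant `∫ p(v) dν(v)` of the law of the index. -/
noncomputable def indexMass (F : ParametricFamily Λ 𝒳 M μ) (q : Measure Λ) (𝔖 : V → Fin d → 𝒳)
    (ν : Measure V) (c : V → Fin d) : ℝ≥0∞ :=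
  ∫⁻ v, F.marginal q (𝔖 v (c v)) ∂ν

theorem measurable_marginal_index [SFinite q] (h𝔖 : ∀ i, Measurable fun v => 𝔖 v i)
    (hc : Measurable c) : Measurable fun v => F.marginal q (𝔖 v (c v)) := by
  have h : Measurable fun z : V × Fin d => F.marginal q (𝔖 z.1 z.2) :=
    measurable_from_prod_countable_left fun i => (F.measurable_marginal q).comp (h𝔖 i)
  exact h.comp (measurable_id.prodMk hc)

theorem indexMass_ne_top [SFinite q] (h𝔖 : ∀ i, Measurable fun v => 𝔖 v i)
    (hγ : 0 < F.mapProb q 𝔖) (hν : IsIndexMeasure μ 𝔖 ν) : F.indexMass q 𝔖 ν c ≠ ∞ := by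
  -- Positivity of γ as a real number already excludes infinite mass, since `toReal` sends ∞ to 0.
  refine ne_top_of_le_ne_top (ENNReal.toReal_pos_iff.1 hγ).2.ne ?_
  rw [← hν.sum_lintegral h𝔖 (F.measurable_marginal q)]
  exact lintegral_mono fun v => Finset.single_le_sum (f := fun i => F.marginal q (𝔖 v i))
    (fun _ _ => zero_le) (Finset.mem_univ (c v))

/-- If p vanished at almost every chosen point, it would vanish at every point of almost every 𝔖(v),
forcing γ = 0. -/
theorem indexMass_ne_zero [SFinite q] (h𝔖 : ∀ i, Measurable fun v => 𝔖 v i) (hc : Measurable c)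
    (hγ : 0 < F.mapProb q 𝔖) (hν : IsIndexMeasure μ 𝔖 ν)
    (hvan : ∀ v i j, F.marginal q (𝔖 v i) = 0 → F.marginal q (𝔖 v j) = 0) :
    F.indexMass q 𝔖 ν c ≠ 0 := by
  intro h0
  rw [indexMass, lintegral_eq_zero_iff (measurable_marginal_index h𝔖 hc)] at h0
  refine (ENNReal.toReal_pos_iff.1 hγ).1.ne' ?_
  rw [← hν.sum_lintegral h𝔖 (F.measurable_marginal q)]
  refine (lintegral_congr_ae ?_).trans lintegral_zero
  filter_upwards [h0] with v hv
  exact Finset.sum_eq_zero fun i _ => hvan v _ i hv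

theorem isProbabilityMeasure_indexLaw (h0 : F.indexMass q 𝔖 ν c ≠ 0)
    (h1 : F.indexMass q 𝔖 ν c ≠ ∞) : IsProbabilityMeasure (F.indexLaw q 𝔖 ν c) := by
  refine ⟨?_⟩
  rw [indexLaw, Measure.smul_apply, withDensity_apply _ MeasurableSet.univ, Measure.restrict_univ]
  exact ENNReal.inv_mul_cancel h0 h1

/-- Properties of almost every data point hold at all points of almost every `𝔖(V)`. -/
theorem ae_indexLaw_of_ae_dataLaw [SFinite q] (h𝔖 : ∀ i, Measurable fun v => 𝔖 v i)
    (hc : Measurable c) (hν : IsIndexMeasure μ 𝔖 ν)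
    (hvan : ∀ v i j, F.marginal q (𝔖 v i) = 0 → F.marginal q (𝔖 v j) = 0)
    {Q : 𝒳 → Prop} (hQ : ∀ᵐ x ∂(F.dataLaw q), Q x) :
    ∀ᵐ v ∂(F.indexLaw q 𝔖 ν c), ∀ i, Q (𝔖 v i) := by
  have h1 := (ae_withDensity_iff (F.measurable_marginal q)).1 hQ
  have h2 : ∀ᵐ v ∂ν, ∀ i, F.marginal q (𝔖 v i) ≠ 0 → Q (𝔖 v i) := by
    refine ae_all_iff.2 fun i => ?_
    have h3 : ∀ᵐ x ∂(ν.map fun v => 𝔖 v i), F.marginal q x ≠ 0 → Q x := by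
      -- Each pushforward is one summand of μ restricted to the range, so μ-null sets pull back to
      -- ν-null sets.
      have hle : ν.map (fun v => 𝔖 v i) ≤ μ :=
        (Finset.single_le_sum (f := fun i => ν.map fun v => 𝔖 v i) (fun _ _ => Measure.zero_le _)
          (Finset.mem_univ i)).trans (hν.le.trans Measure.restrict_le_self)
      exact hle.absolutelyContinuous.ae_le h1
    exact ae_of_ae_map (h𝔖 i).aemeasurable h3
  rw [indexLaw]
  refine Measure.ae_smul_measure ?_ _
  rw [ae_withDensity_iff (measurable_marginal_index h𝔖 hc)]
  filter_upwards [h2] with v hv hp i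
  exact hv i fun h0 => hp (hvan v i _ h0)

theorem IsIsotropic.nat_mul_indexMass [SFinite q] (hiso : F.IsIsotropic q 𝔖)
    (h𝔖 : ∀ i, Measurable fun v => 𝔖 v i) (hc : Measurable c) (hν : IsIndexMeasure μ 𝔖 ν) :
    d * F.indexMass q 𝔖 ν c = ∫⁻ x in mapRange 𝔖, F.marginal q x ∂μ := by
  rw [← hν.sum_lintegral h𝔖 (F.measurable_marginal q), indexMass,
    ← lintegral_const_mul _ (measurable_marginal_index h𝔖 hc)]
  refine lintegral_congr fun v => ?_
  simp [fun i => hiso v i (c v)]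

/-- Isotropy lets the weight p(v) be replaced by the density at each point of 𝔖(v) separately; the
sum then becomes the integral of pR over the range. The inequality comes from enlarging the range to
the whole space. -/
theorem IsIsotropic.lintegral_indexLaw_le [SFinite q] (hiso : F.IsIsotropic q 𝔖)
    (h𝔖 : ∀ i, Measurable fun v => 𝔖 v i) (hc : Measurable c) (hν : IsIndexMeasure μ 𝔖 ν)
    {R : 𝒳 → ℝ≥0∞} (hR : Measurable R) :
    ∫⁻ v, ∑ i, R (𝔖 v i) ∂(F.indexLaw q 𝔖 ν c) ≤
      (F.indexMass q 𝔖 ν c)⁻¹ * ∫⁻ x, R x ∂(F.dataLaw q) := by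
  rw [indexLaw, lintegral_smul_measure, smul_eq_mul]
  refine mul_le_mul_right ?_ _
  have hRi : Measurable fun v => ∑ i, R (𝔖 v i) :=
    Finset.measurable_sum _ fun i _ => hR.comp (h𝔖 i)
  rw [dataLaw, lintegral_withDensity_eq_lintegral_mul _ (F.measurable_marginal q) hR,
    lintegral_withDensity_eq_lintegral_mul _ (measurable_marginal_index h𝔖 hc) hRi]
  refine le_trans (le_of_eq ?_) (setLIntegral_le_lintegral (mapRange 𝔖) _)
  rw [← hν.sum_lintegral h𝔖 ((F.measurable_marginal q).mul hR)]
  refine lintegral_congr fun v => ?_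
  simp only [Pi.mul_apply, Finset.mul_sum]
  exact Finset.sum_congr rfl fun i _ => by rw [hiso v (c v) i]

/-- Averaging the Shannon lower bounds for the noise density `∝ exp (-a |t| ^ k)` over the index. -/
theorem meanEntropy_le_of_lintegral_pointRisk [IsProbabilityMeasure q]
    (h𝔖 : F.IsInterpolationMap q 𝔖) (hγ : 0 < F.mapProb q 𝔖) (hν : IsIndexMeasure μ 𝔖 ν)
    (hc : Measurable c)
    (hint : Integrable (fun v => diffEntropy (F.sampleLaw q (𝔖 v))) (F.indexLaw q 𝔖 ν c))
    (hiso : F.IsIsotropic q 𝔖) {π : Measure ((𝒳 → Fin M → ℝ) × (𝒳 → Fin M → ℝ))}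
    (hπ : π.fst = F.regressionLaw q) (hI : mutualInfo π ≠ ∞) {k : ℕ}
    (hmeas : AEMeasurable (pointRisk k π) (F.dataLaw q)) {T : ℝ} (hT : 0 ≤ T)
    (hrisk : ∫⁻ x, pointRisk k π x ∂(F.dataLaw q) ≤ ENNReal.ofReal T) {a b : ℝ} (ha : 0 < a)
    (hi : Integrable fun t : ℝ => Real.exp (-a * |t| ^ k))
    (hb : ∫ t : ℝ, Real.exp (-a * |t| ^ k) = Real.exp b) :
    F.meanEntropy q 𝔖 ν c ≤ (mutualInfo π).toReal + ((M - 1 : ℕ) * d * b +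
      a * (d / F.mapProb q 𝔖 * T)) := by
  have hvan : ∀ v i j, F.marginal q (𝔖 v i) = 0 → F.marginal q (𝔖 v j) = 0 :=
    fun v i j h => hiso v i j ▸ h
  have hZ0 := indexMass_ne_zero h𝔖.measurable hc hγ hν hvan
  have hZ1 := indexMass_ne_top (c := c) h𝔖.measurable hγ hν
  have := isProbabilityMeasure_indexLaw hZ0 hZ1
  -- The risk is only almost everywhere measurable; its measurable version agrees with it at all
  -- points of almost every 𝔖(V).
  set R := hmeas.mk _
  have hRm : Measurable R := hmeas.measurable_mk
  have hRle : ∫⁻ x, R x ∂(F.dataLaw q) ≤ ENNReal.ofReal T := by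
    rwa [← lintegral_congr_ae hmeas.ae_eq_mk]
  set r : V → ℝ≥0∞ := fun v => ∑ i, R (𝔖 v i)
  have hrm : Measurable r := Finset.measurable_sum _ fun i _ => hRm.comp (h𝔖.measurable i)
  have hrle : ∫⁻ v, r v ∂(F.indexLaw q 𝔖 ν c) ≤ (F.indexMass q 𝔖 ν c)⁻¹ * ENNReal.ofReal T :=
    (hiso.lintegral_indexLaw_le h𝔖.measurable hc hν hRm).trans (mul_le_mul_right hRle _)
  have hne : (F.indexMass q 𝔖 ν c)⁻¹ * ENNReal.ofReal T ≠ ∞ :=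
    ENNReal.mul_ne_top (ENNReal.inv_ne_top.2 hZ0) ENNReal.ofReal_ne_top
  have hrfin := ne_top_of_le_ne_top hne hrle
  have hrint : Integrable (fun v => (r v).toReal) (F.indexLaw q 𝔖 ν c) :=
    integrable_toReal_of_lintegral_ne_top hrm.aemeasurable hrfin
  have hγd : F.mapProb q 𝔖 = d * (F.indexMass q 𝔖 ν c).toReal := by
    rw [mapProb, ← hiso.nat_mul_indexMass h𝔖.measurable hc hν, ENNReal.toReal_mul]
    simp
  have hrle' : ∫ v, (r v).toReal ∂(F.indexLaw q 𝔖 ν c) ≤ d / F.mapProb q 𝔖 * T := by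
    rw [integral_toReal hrm.aemeasurable (ae_lt_top hrm hrfin)]
    refine (ENNReal.toReal_mono hne hrle).trans (le_of_eq ?_)
    have hd : (d : ℝ) ≠ 0 := by
      rintro h0
      rw [hγd, h0, zero_mul] at hγ
      exact lt_irrefl _ hγ
    rw [ENNReal.toReal_mul, ENNReal.toReal_inv, ENNReal.toReal_ofReal hT, hγd]
    field_simp
  have hpt : ∀ᵐ v ∂(F.indexLaw q 𝔖 ν c), diffEntropy (F.sampleLaw q (𝔖 v)) ≤
      (mutualInfo π).toReal + ((M - 1 : ℕ) * d * b + a * (r v).toReal) := by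
    filter_upwards [ae_indexLaw_of_ae_dataLaw h𝔖.measurable hc hν hvan hmeas.ae_eq_mk,
      ae_lt_top hrm hrfin] with v hv hv'
    have hsum : ∑ i, pointRisk k π (𝔖 v i) = r v := Finset.sum_congr rfl fun i _ => hv i
    rw [← hsum]
    refine diffEntropy_le_of_pointRisk hπ hI (h𝔖.isInterpolationSet v) (fun i => ?_) ha hi hb
    rw [← hsum] at hv'
    exact (ENNReal.sum_lt_top.1 hv' i (Finset.mem_univ i)).ne
  have hmono := integral_mono_ae hint
    ((integrable_const _).add ((integrable_const _).add (hrint.const_mul a))) hpt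
  have hadd : Integrable (fun v => (M - 1 : ℕ) * d * b + a * (r v).toReal) (F.indexLaw q 𝔖 ν c) :=
    (integrable_const _).add (hrint.const_mul a)
  simp only [Pi.add_apply] at hmono
  rw [integral_add (integrable_const _) hadd,
    integral_add (integrable_const _) (hrint.const_mul a), integral_const_mul a] at hmono
  simp only [integral_const, probReal_univ, smul_eq_mul, one_mul] at hmono
  refine hmono.trans ?_
  gcongr

end ParametricFamily

end RateDistortion
-- The three rate-distortion bounds
open RateDistortion ParametricFamily in
theorem mainTheorem9 {Λ 𝒳 V : Type*} [MeasurableSpace Λ] [MeasurableSpace 𝒳] [MeasurableSpace V]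
    (M : ℕ) (hM : 2 ≤ M) (μ : Measure 𝒳) [SigmaFinite μ]
    (F : RateDistortion.ParametricFamily Λ 𝒳 M μ) (q : Measure Λ) [IsProbabilityMeasure q]
    (d : ℕ) (𝔖 : V → Fin d → 𝒳) (h𝔖 : F.IsInterpolationMap q 𝔖)
    (hγ : 0 < F.mapProb q 𝔖)
    (ν : Measure V) (hν : RateDistortion.ParametricFamily.IsIndexMeasure μ 𝔖 ν)
    (c : V → Fin d) (hc : Measurable c)
    (hint : Integrable (fun v => RateDistortion.diffEntropy (F.sampleLaw q (𝔖 v)))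
      (F.indexLaw q 𝔖 ν c))
    (D : ℝ) (hD : 0 < D) :
    (F.IsIsotropic q 𝔖 →
      ENNReal.ofReal (max (F.meanEntropy q 𝔖 ν c - d * ((M : ℝ) - 1) *
          Real.log (2 * Real.exp 1 / (((M : ℝ) - 1) * F.mapProb q 𝔖) * D)) 0)
        ≤ F.rateDistortion q 1 D) ∧
    (F.IsIsotropic q 𝔖 →
      ENNReal.ofReal (max (F.meanEntropy q 𝔖 ν c - d * ((M : ℝ) - 1) *
          Real.log (√(2 * Real.pi * Real.exp 1 / (((M : ℝ) - 1) * F.mapProb q 𝔖)) * D)) 0)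
        ≤ F.rateDistortion q 2 D) ∧
    ((∀ v i j, F.marginal q (𝔖 v i) = 0 → F.marginal q (𝔖 v j) = 0) →
      ENNReal.ofReal (max (F.meanEntropy q 𝔖 ν c - d * ((M : ℝ) - 1) *
          Real.log (2 * D)) 0)
        ≤ F.rateDistortion q ∞ D) := by
  have hM1 : ((M - 1 : ℕ) : ℝ) = (M : ℝ) - 1 := by
    rw [Nat.cast_sub (by omega)]; simp
  have hMpos : (0 : ℝ) < (M : ℝ) - 1 := by
    have : (2 : ℝ) ≤ M := by exact_mod_cast hM
    linarith
  -- Couplings of infinite mutual information satisfy the bound trivially, and the positive part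
  -- costs nothing.
  have hred : ∀ (x : ℝ) (p : ℝ≥0∞), (∀ π : Measure ((𝒳 → Fin M → ℝ) × (𝒳 → Fin M → ℝ)),
      π.fst = F.regressionLaw q → mutualInfo π ≠ ∞ →
      AEMeasurable (pointRisk p π) (F.dataLaw q) →
      bayesRisk p (F.dataLaw q) π ≤ ENNReal.ofReal D → x ≤ (mutualInfo π).toReal) →
      ENNReal.ofReal (max x 0) ≤ F.rateDistortion q p D := by
    intro x p h
    refine le_iInf₂ fun π hπ => ?_
    by_cases hI : mutualInfo π = ∞
    · simp [hI]
    · exact (ENNReal.ofReal_le_iff_le_toReal hI).2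
        (max_le (h π hπ.1 hI hπ.2.1 hπ.2.2) ENNReal.toReal_nonneg)
  set γ := F.mapProb q 𝔖
  refine ⟨fun hiso => hred _ _ fun π hπ hI hmeas hrisk => ?_,
    fun hiso => hred _ _ fun π hπ hI hmeas hrisk => ?_,
    fun hvan => hred _ _ fun π hπ hI hmeas hrisk => ?_⟩
  -- The averaged loss is at most dD/γ over d(M - 1) coordinates; a is the reciprocal of the
  -- resulting mean absolute error. The linear term then contributes one nat per coordinate, the
  -- factor e in the logarithm.
  · have ha : 0 < (M - 1) * γ / D := by positivity
    have key := meanEntropy_le_of_lintegral_pointRisk (k := 1) (T := D) (a := (M - 1) * γ / D)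
      (b := Real.log (2 / ((M - 1) * γ / D))) h𝔖 hγ hν hc hint hiso hπ hI
      (by simpa using hmeas) hD.le (by simpa [bayesRisk] using hrisk) ha
      (by simpa using integrable_exp_neg_mul_abs ha)
      (by rw [Real.exp_log (by positivity), ← integral_exp_neg_mul_abs ha]; simp)
    have hlog : Real.log (2 * Real.exp 1 / ((M - 1) * γ) * D) =
        Real.log (2 / ((M - 1) * γ / D)) + 1 := by
      have h1 : 2 * Real.exp 1 / ((M - 1) * γ) * D = 2 / ((M - 1) * γ / D) * Real.exp 1 := by
        field_simp
      rw [h1, Real.log_mul (by positivity) (by positivity), Real.log_exp]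
    have hlin : (M - 1) * γ / D * (d / γ * D) = (M - 1) * d := by field_simp
    rw [hM1, hlin] at key
    rw [hlog]
    linarith
  -- Here a = 1/(2σ²) with σ² = D²/((M - 1)γ), the bound on the mean squared error per coordinate.
  -- The quadratic term contributes half a nat per coordinate, the e under the root.
  · have ha : 0 < (M - 1) * γ / (2 * D ^ 2) := by positivity
    have hrisk' : ∫⁻ x, pointRisk (2 : ℕ) π x ∂(F.dataLaw q) ≤ ENNReal.ofReal (D ^ 2) := by
      rw [bayesRisk, if_neg (by simp), one_div, ENNReal.rpow_inv_le_iff (by simp)] at hrisk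
      rw [ENNReal.ofReal_pow hD.le]
      simpa using hrisk
    have key := meanEntropy_le_of_lintegral_pointRisk (k := 2) (T := D ^ 2)
      (a := (M - 1) * γ / (2 * D ^ 2))
      (b := Real.log (√(Real.pi / ((M - 1) * γ / (2 * D ^ 2))))) h𝔖 hγ hν hc hint hiso hπ hI
      (by simpa using hmeas) (sq_nonneg D) hrisk' ha
      (by simpa using integrable_exp_neg_mul_sq ha)
      (by rw [Real.exp_log (by positivity), ← integral_gaussian]; simp)
    have hlog : Real.log (√(2 * Real.pi * Real.exp 1 / ((M - 1) * γ)) * D) =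
        Real.log (√(Real.pi / ((M - 1) * γ / (2 * D ^ 2)))) + 1 / 2 := by
      have h1 : √(2 * Real.pi * Real.exp 1 / ((M - 1) * γ)) * D =
          √(Real.pi / ((M - 1) * γ / (2 * D ^ 2)) * Real.exp 1) := by
        conv_lhs => rw [← Real.sqrt_sq hD.le]
        rw [← Real.sqrt_mul (by positivity)]
        congr 1
        field_simp
      rw [h1, Real.sqrt_mul (by positivity), Real.log_mul (by positivity) (by positivity),
        Real.log_sqrt (Real.exp_pos 1).le, Real.log_exp]
    have hlin : (M - 1) * γ / (2 * D ^ 2) * (d / γ * D ^ 2) = (M - 1) * d / 2 := by field_simp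
    rw [hM1, hlin] at key
    rw [hlog]
    linarith
  · have := isProbabilityMeasure_indexLaw (indexMass_ne_zero h𝔖.measurable hc hγ hν hvan)
      (indexMass_ne_top h𝔖.measurable hγ hν)
    rw [bayesRisk, if_pos rfl] at hrisk
    have hae : ∀ᵐ x ∂(F.dataLaw q), pointRisk ∞ π x ≤ ENNReal.ofReal D := by
      filter_upwards [ENNReal.ae_le_essSup (μ := F.dataLaw q) (pointRisk ∞ π)] with x hx
        using hx.trans hrisk
    have hmono := integral_mono_ae hint
      (integrable_const ((mutualInfo π).toReal + (M - 1 : ℕ) * d * Real.log (2 * D))) <| by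
        filter_upwards [ae_indexLaw_of_ae_dataLaw h𝔖.measurable hc hν hvan hae] with v hv
        exact diffEntropy_le_of_pointRisk_top hπ hI (h𝔖.isInterpolationSet v) hD hv
    simp only [integral_const, probReal_univ, smul_eq_mul, one_mul] at hmono
    rw [hM1] at hmono
    rw [meanEntropy]
    linarith
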